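/- Let $(W,S)$ be any Coxeter system with length function $\ell$, and let $\omega=(\omega_1,\dots,\omega_m)$ be any finite word in $S$ (not necessarily reduced). Identify a subword $\alpha$ of $\omega$ with its index set $I(\alpha)\subseteq\{1,\dots,m\}$, and write $\langle\alpha\rangle\in W$ for the product of its letters. Let $W_\omega=\{\langle\alpha\rangle : \alpha \text{ a subword of } \omega\}$. For $A,C\subseteq\{1,\dots,m\}$ put $A\le_{\mathrm{lex}}C$ if $A=C$ or the minimum of the symmetric difference of $A$ and $C$ lies in $A$. For $u\in W_\omega$, the $\omega$-sorted word $\mathrm{sort}_\omega(u)$ is the subword of $\omega$ whose index set is $\le_{\mathrm{lex}}$-least among the index sets of the subwords $\alpha$ of $\omega$ that are reduced words with $\langle\alpha\rangle=u$. The $\omega$-sorting order on $W_\omega$ is defined by $$u\le_\omega w\iff I(\mathrm{sort}_\omega(u))\subseteq I(\mathrm{sort}_\omega(w)).$$ Then $\le_\omega$ is a (well-defined) partial order on $W_\omega$, and $(W_\omega,\le_\omega)$ is a finite lattice which is 1. join-distributive: for every $x\in W_\omega$ and every nonempty set $Y$ of elements covering $x$, the interval $[x,\bigvee Y]$ is boolean,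 i.e. isomorphic to the lattice of all subsets of a finite set; 2. supersolvable: there is a maximal chain $\mathfrak m$ such that for every maximal chain $\mathfrak c$ the sublattice generated by $\mathfrak m\cup\mathfrak c$ is distributive; 3. graded with rank function $\ell$: $\ell$ is strictly increasing for $\le_\omega$, $\ell(w)=\ell(u)+1$ whenever $w$ covers $u$, and $\ell=0$ at the minimum. -/

import Mathlib

namespace SortingOrder

section Words

variable {B W : Type*} [Group W] {M : CoxeterMatrix B}

/-- The subword of `ω` that consists of the letters in the positions `A`, read from left to right.
Subwords of `ω` are identified with their index sets `A ⊆ I(ω)`. -/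
def subword (ω : List B) (A : Finset (Fin ω.length)) : List B :=
  ((List.finRange ω.length).filter (fun i => i ∈ A)).map ω.get

/-- The set `W_ω` of the group elements that occur as subwords (reduced or not) of `ω`. -/
def subwordElements (cs : CoxeterSystem M W) (ω : List B) : Set W :=
  {w | ∃ A : Finset (Fin ω.length), cs.wordProd (subword ω A) = w}

/-- The lexicographic order on index sets: `A = C`, or the minimum of the symmetric difference
`(A ∪ C) \ (A ∩ C)` lies in `A`. -/
def LexLE {m : ℕ} (A C : Finset (Fin m)) : Prop :=
  A = C ∨ ∃ i ∈ A, IsLeast (((A ∪ C) \ (A ∩ C) : Finset (Fin m)) : Set (Fin m)) i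

/-- The subword of `ω` with index set `A` is `ω`-sorted: it is reduced, and it is the
lexicographically first one among the reduced subwords of `ω` that represent the same element. -/
def IsSorted (cs : CoxeterSystem M W) (ω : List B) (A : Finset (Fin ω.length)) : Prop :=
  cs.IsReduced (subword ω A) ∧
    ∀ C : Finset (Fin ω.length), cs.IsReduced (subword ω C) →
      cs.wordProd (subword ω C) = cs.wordProd (subword ω A) → LexLE A C

/-- `A` is the index set of the `ω`-sorted word of the group element `u`. -/
def IsSortedWordOf (cs : CoxeterSystem M W) (ω : List B) (A : Finset (Fin ω.length))
    (u : W) : Prop :=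
  IsSorted cs ω A ∧ cs.wordProd (subword ω A) = u

/-- The `ω`-sorting order: inclusion of the index sets of the `ω`-sorted words. No default value
is used for elements without a sorted word; reflexivity of this relation on `W_ω` includes that
every element of `W_ω` has one. -/
def SortingLE (cs : CoxeterSystem M W) (ω : List B) (u w : W) : Prop :=
  ∃ A C : Finset (Fin ω.length),
    IsSortedWordOf cs ω A u ∧ IsSortedWordOf cs ω C w ∧ A ⊆ C

end Words

section Lattices

/-- A poset is boolean if it is isomorphic to the collection of all subsets of a finite set. -/
def IsBoolean (Q : Type*) [PartialOrder Q] : Prop :=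
  ∃ n : ℕ, Nonempty (Q ≃o Set (Fin n))

/-- A finite lattice is join-distributive if every atomic interval, that is, every interval from
an element `x` to the join of a nonempty set `Y` of elements covering `x`, is boolean. (For empty
`Y` the interval would be `{x}`, which is boolean.) -/
def IsJoinDistributive (P : Type*) [Lattice P] : Prop :=
  Finite P ∧ ∀ (x : P) (Y : Finset P) (hY : Y.Nonempty), (∀ y ∈ Y, x ⋖ y) →
    IsBoolean (Set.Icc x (Y.sup' hY id))

/-- An M-chain: a maximal chain which, together with any other maximal chain, generates a
distributive sublattice. -/
def IsMChain {P : Type*} [Lattice P] (m : Set P) : Prop :=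
  IsMaxChain (· ≤ ·) m ∧ ∀ c : Set P, IsMaxChain (· ≤ ·) c →
    ∀ x ∈ latticeClosure (m ∪ c), ∀ y ∈ latticeClosure (m ∪ c), ∀ z ∈ latticeClosure (m ∪ c),
      x ⊓ (y ⊔ z) = (x ⊓ y) ⊔ (x ⊓ z)

/-- A finite lattice is supersolvable if it has an M-chain. -/
def IsSupersolvable (P : Type*) [Lattice P] : Prop :=
  Finite P ∧ ∃ m : Set P, IsMChain m

/-- The poset `P` is graded with rank function `ρ`: `ρ` is strictly increasing, increases by one
along covers, and is `0` at minimal elements. -/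
def IsGradedBy (P : Type*) [PartialOrder P] (ρ : P → ℕ) : Prop :=
  StrictMono ρ ∧ (∀ x y : P, x ⋖ y → ρ y = ρ x + 1) ∧ ∀ x : P, IsMin x → ρ x = 0

end Lattices

end SortingOrder

/-! ### Strong exchange, by the action on signed group elements. -/

namespace CoxeterSystem

variable {B W : Type*} [Group W] {M : CoxeterMatrix B} (cs : CoxeterSystem M W)

/-! Call an index set `A` greedy if at every position `i`, taken or skipped, the letter is not a
left descent of the product of the letters that `A` takes after `i`. Strong exchange gives every
element of `W_ω` a greedy subword (`exists_isGreedyFrom`). Greedy subwords are reduced and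
lexicographically first (`IsGreedyFrom.lexLE`), so they are exactly the sorted words. Hence the
sorting order is inclusion of greedy sets, and length is cardinality.

The rest is combinatorics of a set family. Greedy sets are closed under initial segments, and the
first element that one greedy set misses of another can be added to it (`IsGreedyFrom.exchange`, the
heart of the proof). So unions of greedy sets are greedy: joins are unions, and covers add one
element, which gives the grading and join-distributivity. For supersolvability, take the initial
segments of the largest set as M-chain. Together with any maximal chain they lie in a family of
greedy sets closed under union and intersection, where distributivity is that of sets. -/

theorem _root_.Function.End.mul_apply {α : Type*} (f g : Function.End α) (x : α) :
    (f * g) x = f (g x) := rfl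

theorem _root_.Function.End.one_apply {α : Type*} (x : α) : (1 : Function.End α) x = x := rfl

open scoped Classical in
/-- The action of a simple reflection on signed group elements: conjugation, with a change of sign
exactly at the simple reflection itself. -/
noncomputable def signedConjSimple (i : B) : Function.End (W × ZMod 2) :=
  fun x => (cs.simple i * x.1 * cs.simple i, x.2 + if x.1 = cs.simple i then 1 else 0)

-- Each of the `2n` letters changes the sign if the current conjugate of `x.1` equals that letter.
-- Pulled back to `x.1`, these conditions say that `s_j * x.1` is the `l`-th power of `s_i * s_j`,
-- for `l = 0, …, 2n - 1`.
open scoped Classical in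
theorem signedConjSimple_mul_pow_apply (i j : B) (n : ℕ) (x : W × ZMod 2) :
    ((cs.signedConjSimple i * cs.signedConjSimple j) ^ n) x =
      ((cs.simple i * cs.simple j) ^ n * x.1 * ((cs.simple i * cs.simple j) ^ n)⁻¹,
        x.2 + ∑ l ∈ Finset.range (n + n),
          if cs.simple j * x.1 = (cs.simple i * cs.simple j) ^ l then 1 else 0) := by
  have hflip : ∀ k : ℕ, cs.simple j * (cs.simple i * cs.simple j) ^ k =
      ((cs.simple i * cs.simple j) ^ k)⁻¹ * cs.simple j := by
    intro k
    induction k with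
    | zero => simp
    | succ k ih =>
      rw [pow_succ, ← mul_assoc, ih, ← pow_succ, pow_succ', mul_inv_rev]
      simp [mul_assoc]
  induction n with
  | zero => simp; rfl
  | succ n ih =>
    rw [pow_succ', Function.End.mul_apply, ih]
    rw [show n + 1 + (n + 1) = (n + n) + 1 + 1 by ring, Finset.sum_range_succ,
      Finset.sum_range_succ]
    set c := cs.simple i * cs.simple j with hc
    have hj : (cs.simple j)⁻¹ = cs.simple j := cs.inv_simple j
    have h1 : c ^ n * x.1 * (c ^ n)⁻¹ = cs.simple j ↔ cs.simple j * x.1 = c ^ (n + n) := by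
      rw [mul_inv_eq_iff_eq_mul, pow_add, ← eq_inv_mul_iff_mul_eq (b := cs.simple j), hj,
        ← eq_inv_mul_iff_mul_eq, ← mul_assoc (c ^ n)⁻¹, ← hflip, mul_assoc]
    have h2 : cs.simple j * (c ^ n * x.1 * (c ^ n)⁻¹) * cs.simple j = cs.simple i ↔
        cs.simple j * x.1 = c ^ (n + n + 1) := by
      have e : c ^ (n + n + 1) = c ^ n * (c * c ^ n) := by
        rw [← pow_succ', ← pow_add, add_assoc]
      rw [e, ← inv_mul_eq_iff_eq_mul, ← mul_assoc (c ^ n)⁻¹, ← hflip, ← mul_inv_eq_iff_eq_mul,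
        hc, ← mul_inv_eq_iff_eq_mul, hj]
      simp only [mul_assoc]
    simp only [Function.End.mul_apply, signedConjSimple, h1, h2]
    refine Prod.ext ?_ ?_
    · simp [pow_succ', hc, mul_assoc]
    · simp only [add_assoc]

-- If `(s_i s_j) ^ m = 1`, the powers are `m`-periodic, so the two halves of the sign sum agree and
-- cancel mod 2. An infinite bond is encoded by `m = 0`, where the sum is empty.
open scoped Classical in
theorem isLiftable_signedConjSimple : M.IsLiftable cs.signedConjSimple := by
  intro i j
  suffices h : ∀ m : ℕ, (cs.simple i * cs.simple j) ^ m = 1 →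
      (cs.signedConjSimple i * cs.signedConjSimple j) ^ m = 1 from
    h _ (cs.simple_mul_simple_pow i j)
  intro m hm
  funext x
  rw [signedConjSimple_mul_pow_apply, Finset.sum_range_add, Function.End.one_apply]
  have hp (l : ℕ) : (cs.simple i * cs.simple j) ^ (m + l) = (cs.simple i * cs.simple j) ^ l := by
    rw [pow_add, hm, one_mul]
  simp only [hm, one_mul, inv_one, mul_one]
  have hs : (∑ l ∈ Finset.range m, if cs.simple j * x.1 =
      (cs.simple i * cs.simple j) ^ (m + l) then (1 : ZMod 2) else 0) =
      ∑ l ∈ Finset.range m, if cs.simple j * x.1 = (cs.simple i * cs.simple j) ^ l then 1 else 0 :=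
    Finset.sum_congr rfl fun l _ => by rw [hp l]
  rw [hs, CharTwo.add_self_eq_zero, add_zero]

/-- The action of the Coxeter group on signed group elements. -/
noncomputable def signedConj : W →* Function.End (W × ZMod 2) :=
  cs.lift ⟨cs.signedConjSimple, cs.isLiftable_signedConjSimple⟩

theorem signedConj_simple (i : B) : cs.signedConj (cs.simple i) = cs.signedConjSimple i :=
  cs.lift_apply_simple _ i

-- The left side depends only on the group element, hence so does the parity of the count on the
-- right.
open scoped Classical in
theorem signedConj_wordProd_apply (ω : List B) (x : W × ZMod 2) :
    cs.signedConj (cs.wordProd ω) x = (cs.wordProd ω * x.1 * (cs.wordProd ω)⁻¹,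
      x.2 + ((cs.rightInvSeq ω).count x.1 : ℕ)) := by
  induction ω with
  | nil => simp [Function.End.one_apply]
  | cons i ω ih =>
    rw [wordProd_cons, map_mul, Function.End.mul_apply, ih, signedConj_simple,
      signedConjSimple, rightInvSeq, List.count_cons]
    have h : cs.wordProd ω * x.1 * (cs.wordProd ω)⁻¹ = cs.simple i ↔
        (cs.wordProd ω)⁻¹ * cs.simple i * cs.wordProd ω = x.1 := by
      constructor
      · intro h; rw [← h]; group
      · intro h; rw [← h]; group
    refine Prod.ext ?_ ?_
    · simp [mul_assoc]
    · simp [h, add_assoc]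

/-- The parity of the number of occurrences of `t` in the right inversion sequence of any word
for `w`. -/
noncomputable def invParity (w t : W) : ZMod 2 := (cs.signedConj w (t, 0)).2

open scoped Classical in
theorem invParity_wordProd (ω : List B) (t : W) :
    cs.invParity (cs.wordProd ω) t = ((cs.rightInvSeq ω).count t : ℕ) := by
  simp [invParity, signedConj_wordProd_apply]

theorem invParity_mul (v w t : W) :
    cs.invParity (v * w) t = cs.invParity w t + cs.invParity v (w * t * w⁻¹) := by
  classical
  obtain ⟨α, rfl⟩ := cs.wordProd_surjective v
  obtain ⟨β, rfl⟩ := cs.wordProd_surjective w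
  simp [invParity, signedConj_wordProd_apply, Function.End.mul_apply]

/-- For `t = w s w⁻¹`, the contributions of `w` and `w⁻¹` cancel as they do in `w w⁻¹ = 1`, and `s`
contributes 1. -/
theorem IsReflection.invParity_self {t : W} (ht : cs.IsReflection t) : cs.invParity t t = 1 := by
  obtain ⟨w, i, rfl⟩ := ht
  have h1 : cs.invParity (w * w⁻¹) (w * cs.simple i * w⁻¹) = 0 := by
    simp [invParity, Function.End.one_apply]
  have h2 : cs.invParity (cs.simple i) (cs.simple i) = 1 := by
    classical
    have := cs.invParity_wordProd [i] (cs.simple i)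
    simpa using this
  have e1 : w⁻¹ * (w * cs.simple i * w⁻¹) * w⁻¹⁻¹ = cs.simple i := by group
  have e2 : cs.simple i * cs.simple i * (cs.simple i)⁻¹ = cs.simple i := by group
  rw [invParity_mul, e1] at h1
  rw [invParity_mul, e1, invParity_mul, e2, h2, add_comm 1, ← add_assoc, h1, zero_add]

/-- Odd parity forces an inversion, by a reduced word. If `t` were absent, its parity would be even
for `w`, hence odd for `w t`; then `t` would shorten `w t` as well as `w`. -/
theorem IsRightInversion.mem_rightInvSeq {ω : List B} {t : W}
    (h : cs.IsRightInversion (cs.wordProd ω) t) : t ∈ cs.rightInvSeq ω := by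
  classical
  have key : ∀ (w t : W), cs.invParity w t = 1 → cs.IsRightInversion w t := by
    intro w t hw
    obtain ⟨α, hα, rfl⟩ := cs.exists_isReduced w
    apply cs.isRightInversion_of_mem_rightInvSeq hα
    by_contra hn
    rw [invParity_wordProd, List.count_eq_zero_of_not_mem hn] at hw
    simp at hw
  by_contra hn
  have h0 : cs.invParity (cs.wordProd ω) t = 0 := by
    rw [invParity_wordProd, List.count_eq_zero_of_not_mem hn]; simp
  have h1 : cs.invParity (cs.wordProd ω * t) t = 1 := by
    rw [invParity_mul, h.1.invParity_self, mul_inv_cancel_right, h0, add_zero]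
  have h2 := (key _ _ h1).2
  rw [mul_assoc, h.1.mul_self, mul_one] at h2
  exact absurd h.2 (not_lt.mpr h2.le)

/-- The strong exchange property. -/
theorem IsLeftInversion.mem_leftInvSeq {ω : List B} {t : W}
    (h : cs.IsLeftInversion (cs.wordProd ω) t) : t ∈ cs.leftInvSeq ω := by
  have h' : cs.IsRightInversion (cs.wordProd ω.reverse) t := by
    rw [wordProd_reverse, isRightInversion_inv_iff]; exact h
  simpa [rightInvSeq_reverse] using h'.mem_rightInvSeq

/-- If `t * u` covers `u` in the Bruhat order, and a simple reflection is a left descent of the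
larger but not of the smaller element, then `t` is that simple reflection. -/
theorem IsReflection.eq_simple_of_isLeftDescent_mul {t u : W} {i : B} (ht : cs.IsReflection t)
    (hl : cs.length (t * u) = cs.length u + 1) (hu : ¬ cs.IsLeftDescent u i)
    (htu : cs.IsLeftDescent (t * u) i) : t = cs.simple i := by
  obtain ⟨α, hα, hw⟩ := cs.exists_isReduced (cs.simple i * (t * u))
  have hw' : t * u = cs.wordProd (i :: α) := by
    rw [wordProd_cons, ← hw, simple_mul_simple_cancel_left]
  have hαl : α.length = cs.length u := by
    rw [isLeftDescent_iff] at htu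
    rw [← hα.eq, ← hw]; omega
  have hinv : cs.IsLeftInversion (cs.wordProd (i :: α)) t := by
    refine ⟨ht, ?_⟩
    rw [← hw', ← mul_assoc, ht.mul_self, one_mul]; omega
  have hmem := hinv.mem_leftInvSeq
  obtain ⟨j, hj, rfl⟩ := List.getElem_of_mem hmem
  -- Entry 0 is the simple reflection itself. A later entry deletes a letter of `α`, so `u` would
  -- begin with `i` and be shortened by it.
  rcases j with _ | j
  · simp [leftInvSeq]
  · exfalso
    apply hu
    have e := cs.getD_leftInvSeq_mul_wordProd (i :: α) (j + 1)
    rw [List.getD_eq_getElem _ _ hj, ← hw', ← mul_assoc, ht.mul_self, one_mul,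
      List.eraseIdx_cons_succ, wordProd_cons] at e
    unfold IsLeftDescent
    rw [length_leftInvSeq, List.length_cons] at hj
    have := cs.length_wordProd_le (α.eraseIdx j)
    rw [List.length_eraseIdx_of_lt (by omega)] at this
    rw [e, simple_mul_simple_cancel_left, ← e]
    omega

end CoxeterSystem

namespace SortingOrder

/-! ### Subwords and greedy subwords. -/

section Greedy

variable {B W : Type*} [Group W] {M : CoxeterMatrix B} (cs : CoxeterSystem M W) (ω : List B)

theorem filter_or_eq_append {α : Type*} [LinearOrder α] {p q : α → Prop} [DecidablePred p]
    [DecidablePred q] (h : ∀ a b, p a → q b → a < b) :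
    ∀ l : List α, l.Pairwise (· < ·) →
      l.filter (fun a => p a ∨ q a) = l.filter (fun a => p a) ++ l.filter (fun a => q a)
  | [], _ => rfl
  | a :: l, hl => by
    rw [List.pairwise_cons] at hl
    have ih := filter_or_eq_append h l hl.2
    simp only [Bool.decide_or] at ih ⊢
    by_cases hp : p a
    · have hq : ¬ q a := fun hq => lt_irrefl a (h a a hp hq)
      simp [hp, hq, ih]
    · by_cases hq : q a
      · have hn : l.filter (fun b => p b) = [] := by
          simp only [List.filter_eq_nil_iff, decide_eq_true_eq]
          intro b hb hpb
          exact lt_asymm (hl.1 b hb) (h b a hpb hq)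
        rw [hn] at ih
        simp [hp, hq, ih, hn]
      · simp [hp, hq, ih]

theorem subword_union {A C : Finset (Fin ω.length)} (h : ∀ a ∈ A, ∀ c ∈ C, a < c) :
    subword ω (A ∪ C) = subword ω A ++ subword ω C := by
  unfold subword
  rw [← List.map_append, ← filter_or_eq_append (fun a c ha hc => h a ha c hc) _
    (List.pairwise_lt_finRange _)]
  simp only [Finset.mem_union]

theorem subword_singleton (i : Fin ω.length) : subword ω {i} = [ω.get i] := by
  unfold subword
  have : (List.finRange ω.length).filter (fun j => j ∈ ({i} : Finset (Fin ω.length))) = [i] := by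
    simp only [Finset.mem_singleton]
    rw [List.filter_eq, List.count_eq_one_of_mem (List.nodup_finRange _) (List.mem_finRange i)]
    rfl
  rw [this]; rfl

theorem length_subword (A : Finset (Fin ω.length)) : (subword ω A).length = A.card := by
  unfold subword
  rw [List.length_map, ← List.toFinset_card_of_nodup ((List.nodup_finRange _).filter _)]
  congr 1
  ext i; simp

/-- The group element represented by the subword with index set `A`. -/
def val (A : Finset (Fin ω.length)) : W := cs.wordProd (subword ω A)

@[simp] theorem val_empty : val cs ω ∅ = 1 := by
  have := length_subword ω ∅
  simp only [Finset.card_empty, List.length_eq_zero_iff] at this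
  simp [val, this]

theorem val_union {A C : Finset (Fin ω.length)} (h : ∀ a ∈ A, ∀ c ∈ C, a < c) :
    val cs ω (A ∪ C) = val cs ω A * val cs ω C := by
  rw [val, subword_union ω h, CoxeterSystem.wordProd_append]; rfl

theorem val_singleton (i : Fin ω.length) : val cs ω {i} = cs.simple (ω.get i) := by
  simp [val, subword_singleton]

theorem length_val_le (A : Finset (Fin ω.length)) : cs.length (val cs ω A) ≤ A.card := by
  rw [← length_subword]; exact cs.length_wordProd_le _

/-- The part of `A` strictly before `i`. -/
abbrev before {m : ℕ} (A : Finset (Fin m)) (i : Fin m) : Finset (Fin m) := A.filter (· < i)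

/-- The part of `A` strictly after `i`. -/
abbrev after {m : ℕ} (A : Finset (Fin m)) (i : Fin m) : Finset (Fin m) := A.filter (i < ·)

theorem val_eq_of_mem {A : Finset (Fin ω.length)} {i : Fin ω.length} (hi : i ∈ A) :
    val cs ω A = val cs ω (before A i) * cs.simple (ω.get i) * val cs ω (after A i) := by
  have h : A = (before A i ∪ {i}) ∪ after A i := by
    ext j
    simp only [Finset.mem_union, Finset.mem_filter, Finset.mem_singleton]
    grind
  conv_lhs => rw [h]
  rw [val_union, val_union, val_singleton]
  · simp
  · grind

theorem val_eq_of_notMem {A : Finset (Fin ω.length)} {i : Fin ω.length} (hi : i ∉ A) :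
    val cs ω A = val cs ω (before A i) * val cs ω (after A i) := by
  have h : A = before A i ∪ after A i := by
    ext j
    simp only [Finset.mem_union, Finset.mem_filter]
    grind
  conv_lhs => rw [h]
  rw [val_union]
  grind

/-- The strong exchange property for subwords. -/
theorem exists_mul_val_eq_val_erase {t : W} {A : Finset (Fin ω.length)}
    (h : cs.IsLeftInversion (val cs ω A) t) : ∃ y ∈ A, t * val cs ω A = val cs ω (A.erase y) := by
  have hmem : ∀ A : Finset (Fin ω.length), t ∈ cs.leftInvSeq (subword ω A) →
      ∃ y ∈ A, t = val cs ω (before A y) * cs.simple (ω.get y) * (val cs ω (before A y))⁻¹ := by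
    intro A
    induction A using Finset.induction_on_max with
    | empty =>
      have := length_subword ω ∅
      simp only [Finset.card_empty, List.length_eq_zero_iff] at this
      simp [this]
    | insert a A hA ih =>
      have e : insert a A = A ∪ {a} := by grind
      intro ht
      rw [e, subword_union _ (by simpa using hA), subword_singleton, ← List.concat_eq_append,
        CoxeterSystem.leftInvSeq_concat, List.concat_eq_append, List.mem_append] at ht
      rcases ht with ht | ht
      · obtain ⟨y, hy, e⟩ := ih ht
        refine ⟨y, by simp [hy], ?_⟩
        have : before (insert a A) y = before A y := by
          have := hA y hy
          ext j; simp only [Finset.mem_filter, Finset.mem_insert]; grind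
        rw [this]; exact e
      · refine ⟨a, by simp, ?_⟩
        have : before (insert a A) a = A := by
          ext j; simp only [Finset.mem_filter, Finset.mem_insert]; grind
        rw [this]; simpa [val] using ht
  obtain ⟨y, hy, ht⟩ := hmem A (CoxeterSystem.IsLeftInversion.mem_leftInvSeq cs h)
  refine ⟨y, hy, ?_⟩
  have h1 : before (A.erase y) y = before A y := by ext j; simp; grind
  have h2 : after (A.erase y) y = after A y := by ext j; simp; grind
  rw [val_eq_of_mem cs ω hy, val_eq_of_notMem cs ω (Finset.notMem_erase y A), h1, h2, ht]
  simp [mul_assoc]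

/-- `IsGreedyFrom k A` says that no letter of `ω` in a position `i ≥ k`, taken or not, is a left
descent of the product of the letters that `A` takes after `i`. -/
def IsGreedyFrom (k : ℕ) (A : Finset (Fin ω.length)) : Prop :=
  ∀ i : Fin ω.length, k ≤ i → ¬ cs.IsLeftDescent (val cs ω (after A i)) (ω.get i)

variable {cs ω}

/-- The condition at `i` reads only positions strictly after `i`, so membership of `k` itself is
irrelevant. -/
theorem IsGreedyFrom.congr {k : ℕ} {A C : Finset (Fin ω.length)} (hA : IsGreedyFrom cs ω k A)
    (h : ∀ i : Fin ω.length, k < i → (i ∈ A ↔ i ∈ C)) : IsGreedyFrom cs ω k C := by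
  intro i hi
  have : after C i = after A i := by
    ext j
    simp only [Finset.mem_filter, and_congr_left_iff]
    intro hj
    exact (h j (lt_of_le_of_lt hi hj)).symm
  rw [this]; exact hA i hi

theorem IsGreedyFrom.mono {k l : ℕ} {A : Finset (Fin ω.length)} (hA : IsGreedyFrom cs ω k A)
    (h : k ≤ l) : IsGreedyFrom cs ω l A := fun i hi => hA i (h.trans hi)

theorem isGreedyFrom_of_length_le {k : ℕ} (h : ω.length ≤ k) (A : Finset (Fin ω.length)) :
    IsGreedyFrom cs ω k A := fun i hi => absurd i.2 (by omega)

theorem isGreedyFrom_iff_succ (k : Fin ω.length) (A : Finset (Fin ω.length)) :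
    IsGreedyFrom cs ω k A ↔ IsGreedyFrom cs ω (k + 1) A ∧
      ¬ cs.IsLeftDescent (val cs ω (after A k)) (ω.get k) := by
  constructor
  · exact fun h => ⟨h.mono (Nat.le_succ _), h k le_rfl⟩
  · rintro ⟨h, hk⟩ i hi
    rcases hi.eq_or_lt with e | hi
    · obtain rfl : k = i := Fin.ext e
      exact hk
    · exact h i hi

/-- Induction from the end of the word. -/
theorem backward_induction {m : ℕ} {P : ℕ → Prop} (h0 : ∀ k, m ≤ k → P k)
    (hs : ∀ k : Fin m, P (k + 1) → P k) (k : ℕ) : P k := by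
  rcases le_total m k with h | h
  · exact h0 k h
  · induction h using Nat.decreasingInduction with
    | self => exact h0 m le_rfl
    | of_succ k hk ih => exact hs ⟨k, hk⟩ ih

/-- Greedy subwords are reduced. -/
theorem IsGreedyFrom.length_val {k : ℕ} {A : Finset (Fin ω.length)} (hA : IsGreedyFrom cs ω k A)
    (h : ∀ i ∈ A, k ≤ i) : cs.length (val cs ω A) = A.card := by
  induction k using backward_induction (m := ω.length) generalizing A with
  | h0 k hk =>
    obtain rfl : A = ∅ := Finset.eq_empty_of_forall_notMem fun i hi => by
      have := h i hi; have := i.2; omega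
    simp
  | hs k ih =>
    rw [isGreedyFrom_iff_succ] at hA
    have hb : before A k = ∅ := by
      ext j; simp only [Finset.mem_filter]; have := h j; grind
    have ha := ih (A := after A k) (hA.1.congr fun i hi => by
        simp only [Finset.mem_filter]; grind) (fun i hi => by
        simp only [Finset.mem_filter] at hi; grind)
    by_cases hk : k ∈ A
    · have e : A = insert k (after A k) := by
        ext j; simp only [Finset.mem_filter, Finset.mem_insert]; have := h j; grind
      rw [val_eq_of_mem cs ω hk, hb, val_empty, one_mul, cs.not_isLeftDescent_iff.mp hA.2, ha]
      conv_rhs => rw [e]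
      rw [Finset.card_insert_of_notMem (by simp)]
    · have e : A = after A k := by
        ext j; simp only [Finset.mem_filter]; have := h j; grind
      rw [e, ha]

theorem IsGreedyFrom.restrict_after {k : ℕ} {A : Finset (Fin ω.length)} (hA : IsGreedyFrom cs ω k A)
    {i : Fin ω.length} (hi : k ≤ i) : IsGreedyFrom cs ω i (after A i) :=
  (hA.mono hi).congr fun j hj => by simp only [Finset.mem_filter]; grind

theorem not_isLeftDescent_of_mul {u v : W} {i : B}
    (h : cs.length (u * v) = cs.length u + cs.length v) (hd : ¬ cs.IsLeftDescent (u * v) i) :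
    ¬ cs.IsLeftDescent u i := by
  intro hu
  apply hd
  unfold CoxeterSystem.IsLeftDescent at *
  have := cs.length_mul_le (cs.simple i * u) v
  rw [← mul_assoc]; omega

/-- An initial segment of a reduced subword has no more left descents than the subword. -/
theorem not_isLeftDescent_before {A : Finset (Fin ω.length)} (hr : cs.length (val cs ω A) = A.card)
    {i : B} (hd : ¬ cs.IsLeftDescent (val cs ω A) i) (p : Fin ω.length → Prop) [DecidablePred p]
    (hp : ∀ a b, a < b → p b → p a) : ¬ cs.IsLeftDescent (val cs ω (A.filter p)) i := by
  have e : A = A.filter p ∪ A.filter (fun j => ¬ p j) := by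
    rw [Finset.filter_union_filter_not_eq]
  have hv : val cs ω A = val cs ω (A.filter p) * val cs ω (A.filter (fun j => ¬ p j)) := by
    conv_lhs => rw [e]
    apply val_union
    intro a ha c hc
    simp only [Finset.mem_filter] at ha hc
    by_contra! hn
    rcases hn.eq_or_lt with rfl | hn
    · exact hc.2 ha.2
    · exact hc.2 (hp _ _ hn ha.2)
  rw [hv] at hd hr
  refine not_isLeftDescent_of_mul ?_ hd
  have h1 := length_val_le cs ω (A.filter p)
  have h2 := length_val_le cs ω (A.filter (fun j => ¬ p j))
  have h3 := Finset.card_filter_add_card_filter_not (s := A) p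
  have h4 := cs.length_mul_le (val cs ω (A.filter p)) (val cs ω (A.filter (fun j => ¬ p j)))
  omega

/-- Tails of an initial segment are initial segments of the tails of `A`, which are reduced and so
inherit any left descent of their initial segments. -/
theorem IsGreedyFrom.restrict {k : ℕ} {A : Finset (Fin ω.length)} (hA : IsGreedyFrom cs ω k A)
    (p : Fin ω.length → Prop) [DecidablePred p] (hp : ∀ a b, a < b → p b → p a) :
    IsGreedyFrom cs ω k (A.filter p) := by
  intro i hi
  have e : after (A.filter p) i = (after A i).filter p := by
    ext j; simp only [Finset.mem_filter]; tauto
  rw [e]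
  exact not_isLeftDescent_before ((hA.restrict_after hi).length_val (by simp; grind)) (hA i hi) p hp

end Greedy

/-! ### The exchange property of greedy subwords. -/

section Greedy

variable {B W : Type*} [Group W] {M : CoxeterMatrix B} {cs : CoxeterSystem M W} {ω : List B}

/-- If inserting the position `z` into a reduced subword gives a reduced subword and creates the
left descent `i`, then the letter in position `z` acts on the left as the simple reflection `i`. -/
theorem simple_mul_val_before {D : Finset (Fin ω.length)} {z : Fin ω.length} {i : B} (hz : z ∉ D)
    (hD : cs.length (val cs ω D) = D.card)
    (hDz : cs.length (val cs ω (insert z D)) = (insert z D).card)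
    (hd : ¬ cs.IsLeftDescent (val cs ω D) i) (hdz : cs.IsLeftDescent (val cs ω (insert z D)) i) :
    cs.simple i * val cs ω (before D z) = val cs ω (before D z) * cs.simple (ω.get z) := by
  have h1 : before (insert z D) z = before D z := by
    ext j; simp only [Finset.mem_filter, Finset.mem_insert]; grind
  have h2 : after (insert z D) z = after D z := by
    ext j; simp only [Finset.mem_filter, Finset.mem_insert]; grind
  set p := val cs ω (before D z) with hp
  have e : val cs ω (insert z D) = p * cs.simple (ω.get z) * p⁻¹ * val cs ω D := by
    rw [val_eq_of_mem cs ω (Finset.mem_insert_self z D), val_eq_of_notMem cs ω hz, h1, h2, ← hp]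
    simp [mul_assoc]
  rw [e] at hdz hDz
  have ht : p * cs.simple (ω.get z) * p⁻¹ = cs.simple i := by
    refine CoxeterSystem.IsReflection.eq_simple_of_isLeftDescent_mul cs ⟨p, _, rfl⟩ ?_ hd hdz
    rw [hDz, hD, Finset.card_insert_of_notMem hz]
  rw [← ht]; simp

/-- Exchange at level `k` is a hypothesis, so that this can be applied at level `k + 1` within the
induction that proves exchange. The missing elements of `C` are inserted in increasing order. -/
theorem IsGreedyFrom.union_of_insert {k : ℕ}
    (hk : ∀ {A C : Finset (Fin ω.length)} {x : Fin ω.length}, IsGreedyFrom cs ω k A →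
      IsGreedyFrom cs ω k C → x ∈ C → x ∉ A → k ≤ x → (∀ y ∈ C, k ≤ y → y < x → y ∈ A) →
      IsGreedyFrom cs ω k (insert x A))
    {A C : Finset (Fin ω.length)} (hA : IsGreedyFrom cs ω k A) (hC : IsGreedyFrom cs ω k C) :
    IsGreedyFrom cs ω k (A ∪ C) := by
  induction hn : ((C \ A).filter (fun y : Fin ω.length => k ≤ (y : ℕ))).card
    using Nat.strong_induction_on generalizing A with
  | _ n ih =>
    by_cases he : ((C \ A).filter (fun y : Fin ω.length => k ≤ (y : ℕ))).Nonempty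
    · have hmem := Finset.min'_mem _ he
      have hmin := fun y hy => Finset.min'_le ((C \ A).filter (fun y : Fin ω.length => k ≤ (y : ℕ))) y hy
      set x := Finset.min' _ he
      simp only [Finset.mem_filter, Finset.mem_sdiff] at hmem hmin
      have hx := hk hA hC hmem.1.1 hmem.1.2 hmem.2 fun y hy hky hyx => by
        by_contra hyA
        exact absurd (hmin y ⟨⟨hy, hyA⟩, hky⟩) (not_le.mpr hyx)
      refine (ih _ ?_ hx rfl).congr fun i _ => by
        simp only [Finset.mem_union, Finset.mem_insert]; grind
      rw [← hn]
      apply Finset.card_lt_card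
      refine Finset.ssubset_iff_subset_ne.mpr ⟨fun y => by simp; grind, fun h => ?_⟩
      have : x ∈ (C \ insert x A).filter (fun y : Fin ω.length => k ≤ (y : ℕ)) := by
        rw [h]; simp; grind
      simp at this
    · rw [Finset.not_nonempty_iff_eq_empty, Finset.filter_eq_empty_iff] at he
      refine hA.congr fun i hi => ?_
      have := @he i
      simp only [Finset.mem_sdiff, Finset.mem_union] at this ⊢
      have : k ≤ (i : ℕ) := hi.le
      grind

/-- The exchange property of greedy subwords. -/
theorem IsGreedyFrom.exchange {k : ℕ} {A C : Finset (Fin ω.length)} {x : Fin ω.length}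
    (hA : IsGreedyFrom cs ω k A) (hC : IsGreedyFrom cs ω k C) (hxC : x ∈ C) (hxA : x ∉ A)
    (hx : k ≤ x) (hCA : ∀ y ∈ C, k ≤ y → y < x → y ∈ A) : IsGreedyFrom cs ω k (insert x A) := by
  induction k using backward_induction (m := ω.length) generalizing A C x with
  | h0 k hk => exact isGreedyFrom_of_length_le hk _
  | hs k ih =>
    rcases hx.eq_or_lt with e | hx
    · obtain rfl : k = x := Fin.ext e
      exact hA.congr fun i hi => by simp only [Finset.mem_insert]; grind
    have hxk : k < x := hx
    rw [isGreedyFrom_iff_succ]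
    rw [isGreedyFrom_iff_succ] at hA hC
    have hins := ih hA.1 hC.1 hxC hxA hx fun y hy hky hyx => hCA y hy (by omega) hyx
    refine ⟨hins, fun hd => ?_⟩
    have hred : ∀ {E : Finset (Fin ω.length)}, IsGreedyFrom cs ω (k + 1) E → (∀ j ∈ E, k < j) →
        cs.length (val cs ω E) = E.card := fun h hE => h.length_val fun j hj => hE j hj
    obtain ⟨A', hA'⟩ : ∃ A', A' = after A k := ⟨_, rfl⟩
    obtain ⟨C', hC'⟩ : ∃ C', C' = (after C k).filter (· ≤ x) := ⟨_, rfl⟩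
    have mA : ∀ j, j ∈ A' ↔ j ∈ A ∧ k < j := by simp [hA']
    have mC : ∀ j, j ∈ C' ↔ (j ∈ C ∧ k < j) ∧ j ≤ x := by simp [hC']
    have gA : IsGreedyFrom cs ω (k + 1) A' := hA.1.congr fun j hj => by
      have : k < j := by rw [Fin.lt_def]; omega
      simp [mA, this]
    have gaC : IsGreedyFrom cs ω (k + 1) (after C k) := hC.1.congr fun j hj => by
      have : k < j := by rw [Fin.lt_def]; omega
      simp [this]
    have gC : IsGreedyFrom cs ω (k + 1) C' := by
      rw [hC']; exact gaC.restrict _ fun a b hab hb => hab.le.trans hb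
    have gxA : IsGreedyFrom cs ω (k + 1) (insert x A') := hins.congr fun j hj => by
      have : k < j := by rw [Fin.lt_def]; omega
      simp [mA, this]
    have rA := hred gA fun j hj => ((mA j).1 hj).2
    have dA : ¬ cs.IsLeftDescent (val cs ω A') (ω.get k) := hA' ▸ hA.2
    have dC : ¬ cs.IsLeftDescent (val cs ω C') (ω.get k) := by
      rw [hC']
      exact not_isLeftDescent_before (hred gaC (by simp)) hC.2 _ fun a b hab hb => hab.le.trans hb
    have eA : after (insert x A) k = insert x A' := by
      ext j; simp only [Finset.mem_filter, Finset.mem_insert, mA]; grind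
    rw [eA] at hd
    -- Only the condition at `k` is in doubt. If `x` creates the descent `s_k`, then `s_k` passes
    -- through the prefix before `x` and becomes the letter at `x`.
    have hsx := simple_mul_val_before (fun h => hxA ((mA x).1 h).1) rA
      (hred gxA (by simp only [Finset.mem_insert, mA]; grind)) dA hd
    -- interpolate between `C'` and the part of `insert x A'` up to `x`
    let D : ℕ → Finset (Fin ω.length) := fun z => A'.filter (fun j => (j : ℕ) < z) ∪ C'
    have gD : ∀ z, IsGreedyFrom cs ω (k + 1) (D z) := fun z =>
      IsGreedyFrom.union_of_insert (fun h1 h2 h3 h4 h5 h6 => ih h1 h2 h3 h4 h5 h6)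
        (gA.restrict _ fun a b hab hb => lt_trans (Fin.lt_def.mp hab) hb) gC
    have rD : ∀ z, cs.length (val cs ω (D z)) = (D z).card := fun z =>
      hred (gD z) (by simp only [D, Finset.mem_union, Finset.mem_filter, mA, mC]; grind)
    have dD0 : ¬ cs.IsLeftDescent (val cs ω (D 0)) (ω.get k) := by
      have : D 0 = C' := by ext j; simp [D]
      rw [this]; exact dC
    have dDx : cs.IsLeftDescent (val cs ω (D x)) (ω.get k) := by
      have hDx : D x = before A' x ∪ {x} := by
        ext j
        simp only [D, Finset.mem_union, Finset.mem_filter, mA, mC, Finset.mem_singleton]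
        constructor
        · rintro (h | ⟨⟨h1, h2⟩, h3⟩)
          · exact Or.inl h
          · rcases h3.eq_or_lt with rfl | h3
            · exact Or.inr rfl
            · exact Or.inl ⟨⟨hCA j h1 (Fin.le_def.mp h2.le) h3, h2⟩, h3⟩
        · rintro (h | rfl)
          · exact Or.inl h
          · exact Or.inr ⟨⟨hxC, hxk⟩, le_rfl⟩
      have hlt : ¬ cs.IsLeftDescent (val cs ω (before A' x)) (ω.get k) :=
        not_isLeftDescent_before rA dA _ fun a b hab hb => hab.trans hb
      rw [hDx, val_union _ _ (by simp), val_singleton, ← hsx]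
      rw [cs.isLeftDescent_iff_not_isLeftDescent_mul]
      simpa using hlt
    -- `s_k` is a left descent at `D x` but not at `D 0`, so it appears at some step `z < x`.
    have hfirst : ∃ z : ℕ, z < x ∧ ¬ cs.IsLeftDescent (val cs ω (D z)) (ω.get k) ∧
        cs.IsLeftDescent (val cs ω (D (z + 1))) (ω.get k) := by
      by_contra! hn
      have : ∀ z : ℕ, z ≤ x → ¬ cs.IsLeftDescent (val cs ω (D z)) (ω.get k) := by
        intro z
        induction z with
        | zero => exact fun _ => dD0
        | succ z ihz => exact fun hz => hn z (by omega) (ihz (by omega))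
      exact this x le_rfl dDx
    obtain ⟨z', hz', hn, hy⟩ := hfirst
    obtain ⟨z, rfl⟩ : ∃ z : Fin ω.length, (z : ℕ) = z' := ⟨⟨z', by omega⟩, rfl⟩
    have hzx : z < x := hz'
    by_cases hzD : z ∈ A' ∧ z ∉ C'
    · have eD : D (z + 1) = insert z (D z) := by
        ext j
        simp only [D, Finset.mem_union, Finset.mem_filter, Finset.mem_insert]
        have : (j : ℕ) < z + 1 ↔ j = z ∨ (j : ℕ) < z := by rw [Fin.ext_iff]; omega
        rw [this]
        constructor
        · rintro (⟨h, rfl | h'⟩ | h)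
          · exact Or.inl rfl
          · exact Or.inr (Or.inl ⟨h, h'⟩)
          · exact Or.inr (Or.inr h)
        · rintro (rfl | ⟨h, h'⟩ | h)
          · exact Or.inl ⟨hzD.1, Or.inl rfl⟩
          · exact Or.inl ⟨h, Or.inr h'⟩
          · exact Or.inr h
      have hzDz : z ∉ D z := by simp [D, hzD.2]
      have rD1 := rD (z + 1)
      rw [eD] at hy rD1
      have hsz := simple_mul_val_before hzDz (rD z) rD1 hn hy
      have eb : before (D z) z = before A' z := by
        ext j
        simp only [D, Finset.mem_union, Finset.mem_filter, mA, mC]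
        constructor
        · rintro ⟨h | h, hj⟩
          · exact ⟨h.1, hj⟩
          · exact ⟨⟨hCA j h.1.1 (Fin.le_def.mp h.1.2.le) (hj.trans hzx), h.1.2⟩, hj⟩
        · rintro ⟨h, hj⟩
          exact ⟨Or.inl ⟨h, hj⟩, hj⟩
      rw [eb] at hsz
      have hlt : ¬ cs.IsLeftDescent (val cs ω (before A' z)) (ω.get k) :=
        not_isLeftDescent_before rA dA _ fun a b hab hb => hab.trans hb
      have hle : ¬ cs.IsLeftDescent (val cs ω (A'.filter (· ≤ z))) (ω.get k) :=
        not_isLeftDescent_before rA dA _ fun a b hab hb => hab.le.trans hb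
      -- Now `s_k` passes through the prefix of `A'` before `z` as well, so it would be a left
      -- descent of the initial segment of `A'` up to `z`.
      apply hle
      have el : A'.filter (· ≤ z) = before A' z ∪ {z} := by
        ext j
        simp only [Finset.mem_union, Finset.mem_filter, Finset.mem_singleton, le_iff_lt_or_eq]
        constructor
        · rintro ⟨h, h' | rfl⟩
          · exact Or.inl ⟨h, h'⟩
          · exact Or.inr rfl
        · rintro (⟨h, h'⟩ | rfl)
          · exact ⟨h, Or.inl h'⟩
          · exact ⟨hzD.1, Or.inr rfl⟩
      rw [el, val_union _ _ (by simp), val_singleton, ← hsz]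
      rw [cs.isLeftDescent_iff_not_isLeftDescent_mul]
      simpa using hlt
    · have eD : D (z + 1) = D z := by
        ext j
        simp only [D, Finset.mem_union, Finset.mem_filter]
        have : (j : ℕ) < z + 1 ↔ j = z ∨ (j : ℕ) < z := by rw [Fin.ext_iff]; omega
        rw [this]
        constructor
        · rintro (⟨h, rfl | h'⟩ | h)
          · exact Or.inr (by_contra fun hc => hzD ⟨h, hc⟩)
          · exact Or.inl ⟨h, h'⟩
          · exact Or.inr h
        · rintro (⟨h, h'⟩ | h)
          · exact Or.inl ⟨h, Or.inr h'⟩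
          · exact Or.inr h
      rw [eD] at hy
      exact hn hy

/-! ### Greedy subwords are the sorted words. -/

/-- Greedy subwords are determined by the element that they represent: they begin no later than any
other reduced subword for it. -/
theorem IsGreedyFrom.lexLE {A C : Finset (Fin ω.length)} (hA : IsGreedyFrom cs ω 0 A)
    (hC : cs.length (val cs ω C) = C.card) (h : val cs ω C = val cs ω A) : LexLE A C := by
  by_cases hAC : A = C
  · exact Or.inl hAC
  right
  have hne : ((A ∪ C) \ (A ∩ C)).Nonempty := by
    by_contra hn
    rw [Finset.not_nonempty_iff_eq_empty] at hn
    apply hAC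
    ext j
    have : j ∉ ((A ∪ C) \ (A ∩ C)) := by rw [hn]; simp
    simp at this; grind
  have hmem := Finset.min'_mem _ hne
  have hmin := fun y hy => Finset.min'_le ((A ∪ C) \ (A ∩ C)) y hy
  set i := Finset.min' _ hne
  refine ⟨i, ?_, hmem, fun y hy => hmin y hy⟩
  by_contra hiA
  have hiC : i ∈ C := by simp at hmem; grind
  have hb : before C i = before A i := by
    ext j; have := hmin j; simp at this ⊢; grind
  have e := h
  rw [val_eq_of_mem cs ω hiC, val_eq_of_notMem cs ω hiA, hb, mul_assoc, mul_right_inj] at e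
  -- After cancelling the common prefix, the tail of `A` equals `s_i` times the tail of `C`. Since
  -- `C` is reduced, `s_i` is a left descent of it, although `A` skips `i`.
  apply hA i (Nat.zero_le _)
  rw [← e, cs.isLeftDescent_iff_not_isLeftDescent_mul, cs.simple_mul_simple_cancel_left,
    cs.not_isLeftDescent_iff]
  rw [val_eq_of_mem cs ω hiC] at hC
  have h1 := length_val_le cs ω (before C i)
  have h2 := length_val_le cs ω (after C i)
  have h3 := cs.length_mul_le (val cs ω (before C i)) (cs.simple (ω.get i) * val cs ω (after C i))
  have h4 := cs.length_simple_mul (val cs ω (after C i)) (ω.get i)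
  have h5 : C.card = (before C i).card + 1 + (after C i).card := by
    rw [← Finset.card_erase_add_one hiC,
      ← Finset.card_filter_add_card_filter_not (s := C.erase i) (· < i)]
    have e1 : (C.erase i).filter (· < i) = before C i := by ext j; simp; grind
    have e2 : (C.erase i).filter (fun j => ¬ j < i) = after C i := by ext j; simp; grind
    rw [e1, e2]; omega
  rw [mul_assoc] at hC
  omega

/-- Every element that is represented by a subword is represented by a greedy subword. -/
theorem exists_isGreedyFrom (k : ℕ) (A : Finset (Fin ω.length)) :
    ∃ C, IsGreedyFrom cs ω k C ∧ val cs ω C = val cs ω A ∧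
      ∀ i : Fin ω.length, (i : ℕ) < k → (i ∈ C ↔ i ∈ A) := by
  induction k using backward_induction (m := ω.length) generalizing A with
  | h0 k hk => exact ⟨A, isGreedyFrom_of_length_le hk A, rfl, fun _ _ => Iff.rfl⟩
  | hs k ih =>
    obtain ⟨A₁, g₁, v₁, m₁⟩ := ih A
    by_cases hd : cs.IsLeftDescent (val cs ω (after A₁ k)) (ω.get k)
    · obtain ⟨y, hy, ey⟩ := exists_mul_val_eq_val_erase cs ω
        ((cs.isLeftInversion_simple_iff_isLeftDescent _ _).mpr hd)
      have hky : k < y := by simp at hy; exact hy.2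
      -- Deleting `y` multiplies the tail by `s_k`. So drop both `k` and `y` if `k` is taken, and
      -- trade `y` for `k` otherwise; the new tail no longer has the descent `s_k`.
      obtain ⟨A₂, v₂, b₂, a₂⟩ : ∃ A₂, val cs ω A₂ = val cs ω A₁ ∧ before A₂ k = before A₁ k ∧
          after A₂ k = (after A₁ k).erase y := by
        by_cases hk : k ∈ A₁
        · have eb : before ((A₁.erase k).erase y) k = before A₁ k := by ext j; simp; grind
          have ea : after ((A₁.erase k).erase y) k = (after A₁ k).erase y := by ext j; simp; grind
          refine ⟨_, ?_, eb, ea⟩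
          rw [val_eq_of_mem cs ω hk, val_eq_of_notMem cs ω (i := k) (by simp), eb, ea, ← ey,
            mul_assoc]
        · have eb : before (insert k (A₁.erase y)) k = before A₁ k := by ext j; simp; grind
          have ea : after (insert k (A₁.erase y)) k = (after A₁ k).erase y := by ext j; simp; grind
          refine ⟨_, ?_, eb, ea⟩
          rw [val_eq_of_notMem cs ω hk, val_eq_of_mem cs ω (i := k) (by simp), eb, ea, ← ey,
            mul_assoc, cs.simple_mul_simple_cancel_left]
      -- Making the tail greedy again keeps all positions up to `k`, hence also the product of the
      -- tail.
      obtain ⟨A₃, g₃, v₃, m₃⟩ := ih A₂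
      have m₂ : ∀ i, i < k → (i ∈ A₂ ↔ i ∈ A₁) := fun i hi => by
        have := congrArg (i ∈ ·) b₂; simpa [hi] using this
      have b₃ : before A₃ k = before A₂ k := by
        ext j; simp only [Finset.mem_filter, and_congr_left_iff]
        intro hj; exact m₃ j (by rw [Fin.lt_def] at hj; omega)
      have a₃ : val cs ω (after A₃ k) = val cs ω (after A₂ k) := by
        have e := v₃
        have hk := m₃ k (by omega)
        by_cases hk2 : k ∈ A₂
        · rw [val_eq_of_mem cs ω hk2, val_eq_of_mem cs ω (hk.mpr hk2), b₃] at e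
          exact mul_left_cancel e
        · rw [val_eq_of_notMem cs ω hk2, val_eq_of_notMem cs ω (fun h => hk2 (hk.mp h)), b₃] at e
          exact mul_left_cancel e
      refine ⟨A₃, (isGreedyFrom_iff_succ k A₃).mpr ⟨g₃, ?_⟩, v₃.trans (v₂.trans v₁), ?_⟩
      · rw [a₃, a₂, ← ey, ← cs.isLeftDescent_iff_not_isLeftDescent_mul]
        exact hd
      · intro i hi
        rw [m₃ i (by omega), m₂ i hi, m₁ i (by omega)]
    · exact ⟨A₁, (isGreedyFrom_iff_succ k A₁).mpr ⟨g₁, hd⟩, v₁, fun i hi => m₁ i (by omega)⟩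

theorem LexLE.antisymm {m : ℕ} {A C : Finset (Fin m)} (h1 : LexLE A C) (h2 : LexLE C A) :
    A = C := by
  rcases h1 with h | ⟨i, hi, hi'⟩
  · exact h
  rcases h2 with h | ⟨j, hj, hj'⟩
  · exact h.symm
  rw [Finset.union_comm, Finset.inter_comm] at hj'
  obtain rfl := hi'.unique hj'
  have := hi'.1
  simp [hi, hj] at this

theorem IsGreedyFrom.isReduced {A : Finset (Fin ω.length)} (hA : IsGreedyFrom cs ω 0 A) :
    cs.IsReduced (subword ω A) := by
  rw [CoxeterSystem.IsReduced, length_subword]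
  exact hA.length_val fun _ _ => Nat.zero_le _

theorem IsGreedyFrom.isSorted {A : Finset (Fin ω.length)} (hA : IsGreedyFrom cs ω 0 A) :
    IsSorted cs ω A := by
  refine ⟨hA.isReduced, fun C hC h => hA.lexLE ?_ h⟩
  rw [val, ← length_subword]; exact hC

theorem IsSorted.isGreedyFrom {A : Finset (Fin ω.length)} (hA : IsSorted cs ω A) :
    IsGreedyFrom cs ω 0 A := by
  obtain ⟨C, gC, vC, -⟩ := exists_isGreedyFrom (cs := cs) 0 A
  have h1 : LexLE A C := hA.2 C gC.isReduced vC
  have h2 : LexLE C A := gC.isSorted.2 A hA.1 vC.symm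
  rw [h1.antisymm h2]; exact gC

end Greedy

/-! ### Supersolvable antimatroids and their lattices. -/

section Antimatroid

/-- The feasible sets of a supersolvable antimatroid: a family of subsets of a linearly ordered
ground set which contains the empty set and all initial segments of its members, and to each member
of which the first element that it misses of another member can be added. -/
structure IsSupersolvableAntimatroid {m : ℕ} (F : Set (Finset (Fin m))) : Prop where
  empty_mem : ∅ ∈ F
  filter_mem : ∀ A ∈ F, ∀ k : ℕ, A.filter (fun i : Fin m => (i : ℕ) < k) ∈ F
  insert_mem : ∀ A ∈ F, ∀ C ∈ F, ∀ x ∈ C, x ∉ A → (∀ y ∈ C, y < x → y ∈ A) → insert x A ∈ F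

namespace IsSupersolvableAntimatroid

variable {m : ℕ} {F : Set (Finset (Fin m))} (hF : IsSupersolvableAntimatroid F)
include hF

theorem exists_insert_mem {A C : Finset (Fin m)} (hA : A ∈ F) (hC : C ∈ F) (h : ¬ C ⊆ A) :
    ∃ x ∈ C, x ∉ A ∧ insert x A ∈ F := by
  have he : (C \ A).Nonempty := Finset.sdiff_nonempty.mpr h
  have hmem := Finset.min'_mem _ he
  have hmin := fun y hy => Finset.min'_le (C \ A) y hy
  rw [Finset.mem_sdiff] at hmem
  refine ⟨_, hmem.1, hmem.2, hF.insert_mem A hA C hC _ hmem.1 hmem.2 fun y hy hlt => ?_⟩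
  by_contra hyA
  exact absurd (hmin y (Finset.mem_sdiff.mpr ⟨hy, hyA⟩)) (not_le.mpr hlt)

theorem union_mem {A C : Finset (Fin m)} (hA : A ∈ F) (hC : C ∈ F) : A ∪ C ∈ F := by
  induction hn : (C \ A).card using Nat.strong_induction_on generalizing A with
  | _ n ih =>
    by_cases h : C ⊆ A
    · rwa [Finset.union_eq_left.mpr h]
    · obtain ⟨x, hxC, hxA, hx⟩ := hF.exists_insert_mem hA hC h
      have e : A ∪ C = insert x A ∪ C := by ext y; simp; grind
      rw [e]
      refine ih _ ?_ hx rfl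
      rw [← hn]
      apply Finset.card_lt_card
      refine Finset.ssubset_iff_subset_ne.mpr ⟨fun y => by simp; grind, fun h => ?_⟩
      have : x ∈ C \ insert x A := by rw [h]; simp [hxC, hxA]
      simp at this

end IsSupersolvableAntimatroid

/-- Joins are unions. Intersections need not be feasible, so the meet is the union of all feasible
sets contained in both. -/
theorem IsSupersolvableAntimatroid.exists_lattice {m : ℕ} {P : Type*} {φ : P → Finset (Fin m)}
    (hF : IsSupersolvableAntimatroid (Set.range φ)) (hinj : Function.Injective φ) :
    ∃ _ : Lattice P, ∀ a b : P, a ≤ b ↔ φ a ⊆ φ b := by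
  classical
  have hsup : ∀ T : Finset (Finset (Fin m)), (∀ A ∈ T, A ∈ Set.range φ) → T.sup id ∈ Set.range φ := by
    intro T
    induction T using Finset.induction_on with
    | empty => exact fun _ => hF.empty_mem
    | insert A T _ ih =>
      intro h
      rw [Finset.sup_insert]
      exact hF.union_mem (h A (by simp)) (ih fun C hC => h C (by simp [hC]))
  let T : P → P → Finset (Finset (Fin m)) := fun a b =>
    Finset.univ.filter fun A => A ∈ Set.range φ ∧ A ⊆ φ a ∧ A ⊆ φ b
  have hT : ∀ a b, (T a b).sup id ∈ Set.range φ := fun a b => hsup _ fun A hA => by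
    simp only [T, Finset.mem_filter] at hA; exact hA.2.1
  have hTle : ∀ a b, ∀ D : Finset (Fin m), (∀ A ∈ Set.range φ, A ⊆ φ a → A ⊆ φ b → A ⊆ D) →
      (T a b).sup id ⊆ D := fun a b D hD => Finset.sup_le fun A hA => by
    simp only [T, Finset.mem_filter] at hA; exact hD A hA.2.1 hA.2.2.1 hA.2.2.2
  let _ : PartialOrder P := PartialOrder.lift φ hinj
  have hle : ∀ a b : P, a ≤ b ↔ φ a ⊆ φ b := fun _ _ => Iff.rfl
  choose inf hinf using hT
  choose sup hsup using fun a b : P => hF.union_mem (Set.mem_range_self a) (Set.mem_range_self b)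
  refine ⟨
    { sup := sup
      inf := inf
      le_sup_left := fun a b => by rw [hle, hsup]; exact Finset.subset_union_left
      le_sup_right := fun a b => by rw [hle, hsup]; exact Finset.subset_union_right
      sup_le := fun a b c hac hbc => by
        rw [hle, hsup]; exact Finset.union_subset hac hbc
      inf_le_left := fun a b => by rw [hle, hinf]; exact hTle a b _ fun _ _ h _ => h
      inf_le_right := fun a b => by rw [hle, hinf]; exact hTle a b _ fun _ _ _ h => h
      le_inf := fun a b c hab hac => by
        rw [hle] at *
        rw [hinf]
        exact Finset.le_sup (f := id) (s := T b c) (by simp [T, hab, hac]) }, hle⟩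

/-! ### Gradedness, join-distributivity and supersolvability. -/

section Represented

variable {m : ℕ} {P : Type*} [Lattice P] {φ : P → Finset (Fin m)}
  (hF : IsSupersolvableAntimatroid (Set.range φ)) (hφ : ∀ a b : P, a ≤ b ↔ φ a ⊆ φ b)
include hφ

theorem injective_of_le_iff : Function.Injective φ := fun a b h =>
  le_antisymm ((hφ _ _).mpr h.subset) ((hφ _ _).mpr h.symm.subset)

theorem finite_of_le_iff : Finite P := Finite.of_injective φ (injective_of_le_iff hφ)

theorem map_inf_of_mem_range {a b : P} (h : φ a ∩ φ b ∈ Set.range φ) :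
    φ (a ⊓ b) = φ a ∩ φ b := by
  apply Finset.Subset.antisymm
  · exact Finset.subset_inter ((hφ _ _).mp inf_le_left) ((hφ _ _).mp inf_le_right)
  · obtain ⟨c, h⟩ := h
    rw [← h, ← hφ]
    refine le_inf ?_ ?_ <;> rw [hφ, h]
    · exact Finset.inter_subset_left
    · exact Finset.inter_subset_right

include hF

theorem map_sup_of_antimatroid (a b : P) : φ (a ⊔ b) = φ a ∪ φ b := by
  apply Finset.Subset.antisymm
  · obtain ⟨c, h⟩ := hF.union_mem ⟨a, rfl⟩ ⟨b, rfl⟩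
    rw [← h, ← hφ]
    refine sup_le ?_ ?_ <;> rw [hφ, h]
    · exact Finset.subset_union_left
    · exact Finset.subset_union_right
  · exact Finset.union_subset ((hφ _ _).mp le_sup_left) ((hφ _ _).mp le_sup_right)

theorem exists_insert_of_covBy {a b : P} (h : a ⋖ b) :
    ∃ x, x ∉ φ a ∧ φ b = insert x (φ a) := by
  have hlt : ¬ φ b ⊆ φ a := by
    rw [← hφ]; exact not_le_of_gt h.lt
  obtain ⟨x, hxb, hxa, hx⟩ := hF.exists_insert_mem ⟨a, rfl⟩ ⟨b, rfl⟩ hlt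
  obtain ⟨c, hc⟩ := hx
  refine ⟨x, hxa, ?_⟩
  have hab := (hφ _ _).mp h.le
  have hcb : c ≤ b := by rw [hφ, hc]; exact Finset.insert_subset hxb hab
  have hac : a ≤ c := by rw [hφ, hc]; exact Finset.subset_insert _ _
  rcases h.eq_or_eq hac hcb with e | e
  · exfalso; apply hxa; rw [← e, hc]; simp
  · rw [← e, hc]

theorem isGradedBy_card : IsGradedBy P (fun a => (φ a).card) := by
  refine ⟨fun a b h => ?_, fun a b h => ?_, fun a h => ?_⟩
  · apply Finset.card_lt_card
    rw [lt_iff_le_not_ge, hφ, hφ] at h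
    exact h
  · obtain ⟨x, hx, e⟩ := exists_insert_of_covBy hF hφ h
    simp only [e, Finset.card_insert_of_notMem hx]
  · obtain ⟨c, hc⟩ := hF.empty_mem
    have hca : c ≤ a := by rw [hφ, hc]; simp
    have := (hφ _ _).mp (h hca)
    rw [hc] at this
    simp [Finset.subset_empty.mp this]

/-- Each cover `y` of `x` adds one element `f y`, and joins are unions. So every subset of `f(Y)`
can be added to `φ x`, and the interval is the power set of `f(Y)`. -/
theorem isJoinDistributive_of_antimatroid : IsJoinDistributive P := by
  classical
  refine ⟨finite_of_le_iff hφ, fun x Y hY hc => ?_⟩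
  -- Supplies the default values that `choose!` uses outside `Y`.
  have : Nonempty (Fin m) := by
    obtain ⟨y, hy⟩ := hY
    exact ⟨(exists_insert_of_covBy hF hφ (hc y hy)).choose⟩
  choose! f hf1 hf2 using fun y hy => exists_insert_of_covBy hF hφ (hc y hy)
  have hsup : ∀ (Z : Finset P) (hZ : Z.Nonempty), Z ⊆ Y →
      φ (Z.sup' hZ id) = φ x ∪ Z.image f := by
    intro Z hZ
    induction hZ using Finset.Nonempty.cons_induction with
    | singleton y =>
      intro hZ
      have hy : y ∈ Y := hZ (by simp)
      simp only [Finset.sup'_singleton, id, hf2 y hy]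
      ext; simp
    | cons y Z hyZ hZ ih =>
      intro hZY
      have hy : y ∈ Y := hZY (by simp)
      rw [Finset.sup'_cons hZ, map_sup_of_antimatroid hF hφ,
        ih fun z hz => hZY (by simp [hz]), id, hf2 y hy]
      ext; simp
  let S := Y.image f
  have hS : ∀ T : Finset (Fin m), T ⊆ S → φ x ∪ T ∈ Set.range φ := by
    intro T hT
    obtain ⟨Z, hZ, rfl⟩ := Finset.subset_image_iff.mp hT
    rcases Z.eq_empty_or_nonempty with rfl | hne
    · simp
    · rw [← hsup Z hne hZ]; exact ⟨_, rfl⟩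
  have hdisj : ∀ i ∈ S, i ∉ φ x := by
    intro i hi
    obtain ⟨y, hy, rfl⟩ := Finset.mem_image.mp hi
    exact hf1 y hy
  have : Nonempty P := ⟨x⟩
  choose! g hg using hS
  let lift : Set S → Finset (Fin m) := fun T =>
    Finset.univ.filter fun i => ∃ h : i ∈ S, (⟨i, h⟩ : S) ∈ T
  have hlift : ∀ T, lift T ⊆ S := fun T i hi => by
    simp only [lift, Finset.mem_filter, Finset.mem_univ, true_and] at hi
    exact hi.1
  let e : Set.Icc x (Y.sup' hY id) ≃o Set S :=
    { toFun := fun a => {i | (i : Fin m) ∈ (φ a.1 : Finset (Fin m))}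
      invFun := fun T => ⟨g (lift T), by
        constructor
        · rw [hφ, hg _ (hlift T)]; exact Finset.subset_union_left
        · rw [hφ, hg _ (hlift T), hsup Y hY subset_rfl]
          intro i
          simp only [lift, Finset.mem_union, Finset.mem_filter, Finset.mem_univ, true_and]
          rintro (h | ⟨h, -⟩)
          · exact Or.inl h
          · exact Or.inr h⟩
      left_inv := fun a => by
        apply Subtype.ext
        apply injective_of_le_iff hφ
        have h1 := (hφ _ _).mp a.2.1
        have h2 := (hφ _ _).mp a.2.2
        rw [hsup Y hY subset_rfl] at h2
        simp only [hg _ (hlift _), lift]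
        ext i
        simp only [Finset.mem_union, Finset.mem_filter, Finset.mem_univ, true_and,
          Set.mem_ofPred_eq]
        constructor
        · rintro (h | ⟨-, h⟩)
          · exact h1 h
          · exact h
        · intro h
          rcases Finset.mem_union.mp (h2 h) with h' | h'
          · exact Or.inl h'
          · exact Or.inr ⟨h', h⟩
      right_inv := fun T => by
        ext i
        simp only [hg _ (hlift _), lift, Finset.mem_union, Finset.mem_filter, Finset.mem_univ,
          true_and, Set.mem_ofPred_eq, hdisj i i.2, false_or]
        exact ⟨fun ⟨_, h⟩ => h, fun h => ⟨i.2, h⟩⟩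
      map_rel_iff' := fun {a b} => by
        rw [← Subtype.coe_le_coe, hφ]
        have h1 := (hφ _ _).mp b.2.1
        have h2 := (hφ _ _).mp a.2.2
        rw [hsup Y hY subset_rfl] at h2
        constructor
        · intro h i hi
          rcases Finset.mem_union.mp (h2 hi) with h' | h'
          · exact h1 h'
          · exact @h ⟨i, h'⟩ hi
        · intro h i hi
          exact h hi }
  exact ⟨Fintype.card S, ⟨e.trans ((Equiv.Set.congr (Fintype.equivFin S)).toOrderIso
    (fun _ _ h => Set.image_mono h) (fun _ _ h => Set.image_mono h))⟩⟩

theorem isSupersolvable_of_antimatroid : IsSupersolvable P := by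
  classical
  have hfin : Finite P := finite_of_le_iff hφ
  refine ⟨hfin, ?_⟩
  have : Nonempty P := hF.empty_mem.nonempty
  obtain ⟨top, htop⟩ : ∃ t : P, ∀ a, a ≤ t := by
    obtain ⟨t, ht⟩ := Finite.exists_max (fun a : P => (φ a).card)
    refine ⟨t, fun a => ?_⟩
    have h1 : t = a ⊔ t := by
      apply injective_of_le_iff hφ
      exact Finset.eq_of_subset_of_card_le ((hφ _ _).mp le_sup_right) (ht _)
    rw [h1]; exact le_sup_left
  let seg : ℕ → Finset (Fin m) := fun k => (φ top).filter (fun i : Fin m => (i : ℕ) < k)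
  have hseg : ∀ k, seg k ∈ Set.range φ := fun k => hF.filter_mem _ ⟨top, rfl⟩ k
  let c₀ : Set P := {a | ∃ k, φ a = seg k}
  have hmono : ∀ {k l : ℕ}, k ≤ l → seg k ⊆ seg l := fun h i hi => by
    simp only [seg, Finset.mem_filter] at hi ⊢; exact ⟨hi.1, by omega⟩
  have hchain : IsChain (· ≤ ·) c₀ := by
    rintro a ⟨k, hk⟩ b ⟨l, hl⟩ -
    simp only [hφ, hk, hl]
    exact (le_total k l).imp hmono hmono
  have htop_mem : top ∈ c₀ := ⟨m, by simp [seg]⟩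
  -- Let `i` be the first element of `φ top` missing from `φ a`. Comparability with `seg (i + 1)`,
  -- which contains `i`, forces `φ a = seg i`.
  have hmax : ∀ a : P, (∀ b ∈ c₀, a ≤ b ∨ b ≤ a) → a ∈ c₀ := by
    intro a ha
    by_cases h : φ top ⊆ φ a
    · rw [le_antisymm (htop a) ((hφ _ _).mpr h)]; exact htop_mem
    · have he : (φ top \ φ a).Nonempty := Finset.sdiff_nonempty.mpr h
      have hmem := Finset.min'_mem _ he
      have hmin := fun y hy => Finset.min'_le (φ top \ φ a) y hy
      set i := Finset.min' _ he
      rw [Finset.mem_sdiff] at hmem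
      refine ⟨i, Finset.Subset.antisymm (fun j hj => ?_) fun j hj => ?_⟩
      · have hb := ha _ ⟨i + 1, (hseg (i + 1)).choose_spec⟩
        simp only [hφ, (hseg (i + 1)).choose_spec] at hb
        rcases hb with hb | hb
        · have h1 := hb hj
          simp only [seg, Finset.mem_filter] at h1 ⊢
          have h2 : j ≠ i := fun e => hmem.2 (e ▸ hj)
          rw [Ne, Fin.ext_iff] at h2
          exact ⟨h1.1, by omega⟩
        · exact absurd (hb (by simp [seg, hmem.1])) hmem.2
      · simp only [seg, Finset.mem_filter] at hj
        by_contra hja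
        have h1 := hmin j (Finset.mem_sdiff.mpr ⟨hj.1, hja⟩)
        rw [Fin.le_def] at h1
        omega
  refine ⟨c₀, ⟨hchain, fun c hc hsub => Set.Subset.antisymm hsub fun a ha => hmax a fun b hb => ?_⟩,
    fun c hc => ?_⟩
  · exact hc.total ha (hsub hb)
  -- the finite unions of the sets `seg k ∩ φ a` with `a ∈ c`
  let G : Set (Finset (Fin m)) :=
    {A | ∃ T : Finset (ℕ × P), (∀ t ∈ T, t.2 ∈ c) ∧
      A = T.sup (fun t => (φ t.2 : Finset (Fin m)).filter (fun i : Fin m => (i : ℕ) < t.1))}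
  have hGF : G ⊆ Set.range φ := by
    rintro _ ⟨T, -, rfl⟩
    induction T using Finset.induction_on with
    | empty => simpa using hF.empty_mem
    | insert t T _ ih =>
      rw [Finset.sup_insert]
      exact hF.union_mem (hF.filter_mem _ ⟨_, rfl⟩ _) ih
  have hGu : ∀ A ∈ G, ∀ C ∈ G, A ∪ C ∈ G := by
    rintro _ ⟨T, hT, rfl⟩ _ ⟨U, hU, rfl⟩
    refine ⟨T ∪ U, fun t ht => (Finset.mem_union.mp ht).elim (hT t) (hU t), ?_⟩
    rw [Finset.sup_union]; rfl
  have hGi : ∀ A ∈ G, ∀ C ∈ G, A ∩ C ∈ G := by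
    rintro _ ⟨T, hT, rfl⟩ _ ⟨U, hU, rfl⟩
    have hinf : ∀ a ∈ c, ∀ b ∈ c, ∃ d ∈ c,
        φ d = φ a ∩ φ b := by
      intro a ha b hb
      rcases hc.1.total ha hb with h | h
      · exact ⟨a, ha, (Finset.inter_eq_left.mpr ((hφ _ _).mp h)).symm⟩
      · exact ⟨b, hb, (Finset.inter_eq_right.mpr ((hφ _ _).mp h)).symm⟩
    choose! d hd1 hd2 using hinf
    -- Two truncated chain members intersect in the smaller member truncated at the smaller bound.
    refine ⟨(T ×ˢ U).image fun p => (min p.1.1 p.2.1, d p.1.2 p.2.2), fun t ht => ?_, ?_⟩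
    · obtain ⟨p, hp, rfl⟩ := Finset.mem_image.mp ht
      rw [Finset.mem_product] at hp
      exact hd1 _ (hT _ hp.1) _ (hU _ hp.2)
    · ext i
      simp only [Finset.mem_inter, Finset.mem_sup, Finset.mem_filter, Finset.mem_image,
        Finset.mem_product, Prod.exists]
      constructor
      · rintro ⟨⟨t, a, hta, h1, h2⟩, ⟨u, b, hub, h3, h4⟩⟩
        refine ⟨_, _, ⟨t, a, u, b, ⟨hta, hub⟩, rfl⟩, ?_, lt_min h2 h4⟩
        rw [hd2 _ (hT _ hta) _ (hU _ hub)]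
        exact Finset.mem_inter.mpr ⟨h1, h3⟩
      · rintro ⟨_, _, ⟨t, a, u, b, ⟨hta, hub⟩, e⟩, h1, h2⟩
        obtain ⟨rfl, rfl⟩ := Prod.mk.inj e
        rw [hd2 _ (hT _ hta) _ (hU _ hub), Finset.mem_inter] at h1
        rw [lt_min_iff] at h2
        exact ⟨⟨t, a, hta, h1.1, h2.1⟩, ⟨u, b, hub, h1.2, h2.2⟩⟩
  have htopc : top ∈ c := by
    have : c = insert top c := hc.2 (hc.1.insert fun b _ _ => Or.inr (htop b)) (Set.subset_insert _ _)
    rw [this]; exact Set.mem_insert _ _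
  let L : Sublattice P :=
    { carrier := {a | φ a ∈ G}
      supClosed' := fun a ha b hb => by
        simp only [Set.mem_ofPred_eq, map_sup_of_antimatroid hF hφ] at *
        exact hGu _ ha _ hb
      infClosed' := fun a ha b hb => by
        simp only [Set.mem_ofPred_eq] at *
        rw [map_inf_of_mem_range hφ (hGF (hGi _ ha _ hb))]
        exact hGi _ ha _ hb }
  -- `c₀` consists of truncations of `top`, which lies in `c` by maximality; truncating at `m`
  -- changes nothing.
  have hle : latticeClosure (c₀ ∪ c) ⊆ {a | φ a ∈ G} := by
    refine latticeClosure_min ?_ L.isSublattice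
    rintro a (⟨k, hk⟩ | ha)
    · exact ⟨{(k, top)}, by simpa using htopc, by simpa using hk⟩
    · exact ⟨{(m, a)}, by simpa using ha, by simp⟩
  intro x hx y hy z hz
  have gx := hle hx
  have gy := hle hy
  have gz := hle hz
  have i1 := hGi _ gx _ gy
  have i2 := hGi _ gx _ gz
  have i3 : φ x ∩ φ (y ⊔ z) ∈ G := by
    rw [map_sup_of_antimatroid hF hφ]; exact hGi _ gx _ (hGu _ gy _ gz)
  apply injective_of_le_iff hφ
  rw [map_sup_of_antimatroid hF hφ, map_inf_of_mem_range hφ (hGF i1), map_inf_of_mem_range hφ (hGF i2),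
    map_inf_of_mem_range hφ (hGF i3), map_sup_of_antimatroid hF hφ, Finset.inter_union_distrib_left]

end Represented

end Antimatroid

/-! ### The antimatroid of greedy subwords and the main theorem. -/

theorem isSupersolvableAntimatroid_isGreedyFrom {B W : Type*} [Group W] {M : CoxeterMatrix B}
    (cs : CoxeterSystem M W) (ω : List B) :
    IsSupersolvableAntimatroid {A | IsGreedyFrom cs ω 0 A} where
  empty_mem := fun i _ => by simpa using cs.not_isLeftDescent_one _
  filter_mem := fun _ hA _ => hA.restrict _ fun _ _ hab hb => lt_trans (Fin.lt_def.mp hab) hb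
  insert_mem := fun _ hA _ hC _ hx hxA h =>
    hA.exchange hC hx hxA (Nat.zero_le _) fun y hy _ hyx => h y hy hyx

theorem IsGreedyFrom.eq_of_val_eq {B W : Type*} [Group W] {M : CoxeterMatrix B}
    {cs : CoxeterSystem M W} {ω : List B} {A C : Finset (Fin ω.length)}
    (hA : IsGreedyFrom cs ω 0 A) (hC : IsGreedyFrom cs ω 0 C) (h : val cs ω A = val cs ω C) :
    A = C :=
  (hA.isSorted.2 C hC.isReduced h.symm).antisymm (hC.isSorted.2 A hA.isReduced h)

end SortingOrder

open SortingOrder in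
theorem mainTheorem1 {B W : Type*} [Group W] {M : CoxeterMatrix B} (cs : CoxeterSystem M W)
    (ω : List B) :
    ∃ L : Lattice (SortingOrder.subwordElements cs ω),
      (∀ u w : SortingOrder.subwordElements cs ω,
        u ≤ w ↔ SortingOrder.SortingLE cs ω (u : W) (w : W)) ∧
      SortingOrder.IsJoinDistributive (SortingOrder.subwordElements cs ω) ∧
      SortingOrder.IsSupersolvable (SortingOrder.subwordElements cs ω) ∧
      SortingOrder.IsGradedBy (SortingOrder.subwordElements cs ω)
        (fun u => cs.length (u : W)) := by
  have hex : ∀ u : subwordElements cs ω, ∃ A, IsGreedyFrom cs ω 0 A ∧ val cs ω A = u := by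
    rintro ⟨_, A, rfl⟩
    obtain ⟨C, gC, vC, -⟩ := exists_isGreedyFrom (cs := cs) 0 A
    exact ⟨C, gC, vC⟩
  choose φ hg hv using hex
  have hinj : Function.Injective φ := fun u w h => Subtype.ext (by rw [← hv u, ← hv w, h])
  have huniq : ∀ (u : subwordElements cs ω) A, IsSortedWordOf cs ω A u ↔ A = φ u := by
    intro u A
    constructor
    · rintro ⟨hA, hAu⟩
      exact hA.isGreedyFrom.eq_of_val_eq (hg u) (hAu.trans (hv u).symm)
    · rintro rfl
      exact ⟨(hg u).isSorted, hv u⟩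
  have hrange : Set.range φ = {A | IsGreedyFrom cs ω 0 A} := by
    ext A
    constructor
    · rintro ⟨u, rfl⟩
      exact hg u
    · intro hA
      exact ⟨⟨val cs ω A, A, rfl⟩, (hg _).eq_of_val_eq hA (hv _)⟩
  have hF : IsSupersolvableAntimatroid (Set.range φ) :=
    hrange ▸ isSupersolvableAntimatroid_isGreedyFrom cs ω
  obtain ⟨L, hL⟩ := hF.exists_lattice hinj
  have hlen : (fun u : subwordElements cs ω => cs.length (u : W)) = fun u => (φ u).card := by
    funext u
    rw [← hv u]
    exact (hg u).length_val fun _ _ => Nat.zero_le _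
  refine ⟨L, fun u w => ?_, isJoinDistributive_of_antimatroid hF hL,
    isSupersolvable_of_antimatroid hF hL, hlen ▸ isGradedBy_card hF hL⟩
  simp only [SortingLE, huniq, hL]
  constructor
  · exact fun h => ⟨_, _, rfl, rfl, h⟩
  · rintro ⟨_, _, rfl, rfl, h⟩
    exact h
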